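/- Let $K$ be a field, let $\mathcal G$ be an ample Hausdorff groupoid (a Hausdorff topological groupoid whose unit space $\mathcal G^{(0)}$ is locally compact and zero-dimensional and whose range map $r:\mathcal G\to\mathcal G^{(0)}$ is a local homeomorphism), let $\Gamma$ be a discrete group with identity $e$, and let $c:\mathcal G\to\Gamma$ be a locally constant cocycle, i.e. a locally constant map with $c(\gamma_1\gamma_2)=c(\gamma_1)c(\gamma_2)$ for all composable $\gamma_1,\gamma_2$. The Steinberg algebra $A_K(\mathcal G)$ is the $K$-algebra of locally constant, compactly supported functions $\mathcal G\to K$ with the convolution product $(fg)(\gamma)=\sum_{\gamma_1\gamma_2=\gamma}f(\gamma_1)g(\gamma_2)$. It is $\Gamma$-graded by the subspaces $A_g$, $g\in\Gamma$, of functions vanishing outside $c^{-1}(g)$, and a two-sided ideal $J$ of $A_K(\mathcal G)$ is graded if $J=\bigoplus_{g\in\Gamma}(J\cap A_g)$. A set $U\subseteq\mathcal G^{(0)}$ is invariant if, for every $\gamma\in\mathcal G$, $r(\gamma)\in U$ if and only if $s(\gamma)\in U$, where $s$ is the source map; in that case $\mathcal G|_U=\{\gamma\in\mathcal G:r(\gamma)\in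 U\}$, a subgroupoid of $\mathcal G$. If $U$ is also open, $A_K(\mathcal G|_U)$ is regarded as a subset of $A_K(\mathcal G)$ through extension of functions by zero. A topological groupoid $\mathcal H$ is effective if the interior of $\{\gamma\in\mathcal H:r(\gamma)=s(\gamma)\}$ in $\mathcal H$ equals $\mathcal H^{(0)}$, and strongly effective if $\mathcal H|_C$ is effective for every closed invariant set $C\subseteq\mathcal H^{(0)}$. Suppose that the groupoid $c^{-1}(e)$ is strongly effective. Then $$U\mapsto A_K(\mathcal G|_U)$$ is an isomorphism from the lattice of open invariant subsets of $\mathcal G^{(0)}$ (with union and intersection) onto the lattice of graded ideals of $A_K(\mathcal G)$ (with sum and intersection). -/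

import Mathlib

/-! ### Groupoids -/

/-- A groupoid presented by its set of arrows `G`.  Units are identified with identity arrows, so
source and range take values in `G`; the product of `a` and `b` exists exactly when
`src a = rng b`. -/
class ArrowGroupoid (G : Type*) where
  src : G → G
  rng : G → G
  mul : (a b : G) → src a = rng b → G
  inv : G → G
  src_src : ∀ a, src (src a) = src a
  rng_src : ∀ a, rng (src a) = src a
  src_rng : ∀ a, src (rng a) = rng a
  rng_rng : ∀ a, rng (rng a) = rng a
  src_mul : ∀ a b h, src (mul a b h) = src b
  rng_mul : ∀ a b h, rng (mul a b h) = rng a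
  mul_assoc : ∀ a b c (hab : src a = rng b) (hbc : src b = rng c),
    mul (mul a b hab) c ((src_mul a b hab).trans hbc) =
      mul a (mul b c hbc) (hab.trans (rng_mul b c hbc).symm)
  mul_src : ∀ a, mul a (src a) (rng_src a).symm = a
  rng_mul_self : ∀ a, mul (rng a) a (src_rng a) = a
  src_inv : ∀ a, src (inv a) = rng a
  rng_inv : ∀ a, rng (inv a) = src a
  inv_mul : ∀ a, mul (inv a) a (src_inv a) = src a
  mul_inv : ∀ a, mul a (inv a) (rng_inv a).symm = rng a

namespace ArrowGroupoid

/-- The unit space of `G`; it carries the relative topology when `G` is a space. -/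
abbrev UnitSpace (G : Type*) [ArrowGroupoid G] : Type _ := {x : G // src x = x}

section Algebraic

variable {G : Type*} [ArrowGroupoid G]

/-- The source map, as a map to the unit space. -/
def s (a : G) : UnitSpace G := ⟨src a, src_src a⟩

/-- The range map, as a map to the unit space. -/
def r (a : G) : UnitSpace G := ⟨rng a, src_rng a⟩

/-- A set of units is invariant if it contains the range of an arrow exactly when it contains
the source of that arrow. -/
def Invariant (U : Set (UnitSpace G)) : Prop := ∀ a : G, r a ∈ U ↔ s a ∈ U

variable (G) in
/-- The isotropy bundle of `G`. -/
def Iso : Set G := {a | rng a = src a}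

/-- A map to a group that is multiplicative on composable pairs. -/
def IsCocycle {Γ : Type*} [Group Γ] (c : G → Γ) : Prop :=
  ∀ (a b : G) (h : src a = rng b), c (mul a b h) = c a * c b

lemma mul_congr {a a' b b' : G} (ha : a = a') (hb : b = b') (h : src a = rng b)
    (h' : src a' = rng b') : mul a b h = mul a' b' h' := by
  subst ha; subst hb; rfl

lemma inv_mul_cancel_left (a b : G) (h : src a = rng b) (h' : src (inv a) = rng (mul a b h)) :
    mul (inv a) (mul a b h) h' = b := by
  rw [← mul_assoc (inv a) a b (src_inv a) h]
  rw [mul_congr ((inv_mul a).trans h) rfl _ (src_rng b), rng_mul_self]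

lemma inv_inv (a : G) : inv (inv a) = a := by
  have h : mul (inv (inv a)) (mul (inv a) a (src_inv a))
      ((src_inv _).trans (rng_mul _ _ _).symm) = a := inv_mul_cancel_left _ _ _ _
  rw [mul_congr rfl (inv_mul a) _ (by rw [src_inv, rng_inv, rng_src])] at h
  rw [mul_congr rfl (show src a = src (inv (inv a)) by rw [src_inv, rng_inv]) _
    (rng_src _).symm, mul_src] at h
  exact h

lemma mul_inv_cancel_left (a b : G) (h : rng a = rng b)
    (h' : src a = rng (mul (inv a) b ((src_inv a).trans h))) :
    mul a (mul (inv a) b ((src_inv a).trans h)) h' = b := by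
  rw [mul_congr (inv_inv a).symm rfl h' ((src_inv _).trans (rng_mul _ _ _).symm)]
  exact inv_mul_cancel_left _ _ _ _

end Algebraic

/-! ### Subgroupoids -/

/-- A subset of `G` closed under products and inverses. -/
structure Sub (G : Type*) [ArrowGroupoid G] where
  carrier : Set G
  mul_mem : ∀ (a b : G) (h : src a = rng b), a ∈ carrier → b ∈ carrier → mul a b h ∈ carrier
  inv_mem : ∀ a ∈ carrier, inv a ∈ carrier

section Subgroupoids

variable {G : Type*} [ArrowGroupoid G]

lemma Sub.src_mem (S : Sub G) (a : G) (ha : a ∈ S.carrier) : src a ∈ S.carrier := by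
  rw [← inv_mul a]; exact S.mul_mem _ _ _ (S.inv_mem a ha) ha

lemma Sub.rng_mem (S : Sub G) (a : G) (ha : a ∈ S.carrier) : rng a ∈ S.carrier := by
  rw [← mul_inv a]; exact S.mul_mem _ _ _ ha (S.inv_mem a ha)

/-- A subgroupoid is a groupoid in its own right. -/
instance (S : Sub G) : ArrowGroupoid S.carrier where
  src a := ⟨src a.1, S.src_mem a.1 a.2⟩
  rng a := ⟨rng a.1, S.rng_mem a.1 a.2⟩
  mul a b h := ⟨mul a.1 b.1 (congrArg Subtype.val h),
    S.mul_mem a.1 b.1 (congrArg Subtype.val h) a.2 b.2⟩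
  inv a := ⟨inv a.1, S.inv_mem a.1 a.2⟩
  src_src a := Subtype.ext (src_src a.1)
  rng_src a := Subtype.ext (rng_src a.1)
  src_rng a := Subtype.ext (src_rng a.1)
  rng_rng a := Subtype.ext (rng_rng a.1)
  src_mul a b _ := Subtype.ext (src_mul a.1 b.1 _)
  rng_mul a b _ := Subtype.ext (rng_mul a.1 b.1 _)
  mul_assoc a b c _ _ := Subtype.ext (mul_assoc a.1 b.1 c.1 _ _)
  mul_src a := Subtype.ext (mul_src a.1)
  rng_mul_self a := Subtype.ext (rng_mul_self a.1)
  src_inv a := Subtype.ext (src_inv a.1)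
  rng_inv a := Subtype.ext (rng_inv a.1)
  inv_mul a := Subtype.ext (inv_mul a.1)
  mul_inv a := Subtype.ext (mul_inv a.1)

/-- The restriction `G|_U` of `G` to an invariant set of units. -/
def restrict (U : Set (UnitSpace G)) (hU : Invariant U) : Sub G where
  carrier := {a | r a ∈ U}
  mul_mem a b h ha _ := by
    have : r (mul a b h) = r a := Subtype.ext (rng_mul a b h)
    simpa [this] using ha
  inv_mem a ha := by
    have : r (inv a) = s a := Subtype.ext (rng_inv a)
    simpa [this] using (hU a).1 ha

lemma IsCocycle.map_rng {Γ : Type*} [Group Γ] {c : G → Γ} (hc : IsCocycle c) (a : G) :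
    c (rng a) = 1 := by
  have h := hc (rng a) a (src_rng a)
  rw [rng_mul_self] at h
  simpa using h.symm

/-- The subgroupoid of arrows on which a cocycle takes the value `1`. -/
def kernel {Γ : Type*} [Group Γ] (c : G → Γ) (hc : IsCocycle c) : Sub G where
  carrier := {a | c a = 1}
  mul_mem a b h ha hb := by
    simp only [Set.mem_ofPred_eq] at *
    rw [hc, ha, hb, one_mul]
  inv_mem a ha := by
    simp only [Set.mem_ofPred_eq] at *
    have h := hc a (inv a) (rng_inv a).symm
    rw [mul_inv, hc.map_rng, ha, one_mul] at h
    exact h.symm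

end Subgroupoids

/-! ### Topological conditions -/

/-- Étale topological groupoids: product and inverse are continuous, the unit space is locally
compact, and the range map is a local homeomorphism onto the unit space.  (The Hausdorff property
is assumed separately.) -/
class IsEtale (G : Type*) [TopologicalSpace G] [ArrowGroupoid G] : Prop where
  continuous_mul : Continuous fun p : {p : G × G // src p.1 = rng p.2} => mul p.1.1 p.1.2 p.2
  continuous_inv : Continuous (inv : G → G)
  locallyCompact_units : LocallyCompactSpace (UnitSpace G)
  isLocalHomeomorph_r : IsLocalHomeomorph (r : G → UnitSpace G)

/-- Ample groupoids: étale groupoids with zero-dimensional unit space. -/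
class IsAmple (G : Type*) [TopologicalSpace G] [ArrowGroupoid G] : Prop extends IsEtale G where
  zeroDimensional_units :
    TopologicalSpace.IsTopologicalBasis {C : Set (UnitSpace G) | IsClopen C}

/-- `G` is effective if the interior of its isotropy bundle is its unit space. -/
def Effective (G : Type*) [TopologicalSpace G] [ArrowGroupoid G] : Prop :=
  interior (Iso G) = {x : G | src x = x}

/-- `G` is strongly effective if its restriction to every closed invariant set of units is
effective. -/
def StronglyEffective (G : Type*) [TopologicalSpace G] [ArrowGroupoid G] : Prop :=
  ∀ (C : Set (UnitSpace G)) (hC : Invariant C), IsClosed C → Effective (restrict C hC).carrier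

end ArrowGroupoid

/-! ### The Steinberg algebra -/

/-- The `R`-module `C_c(X, R)` of locally constant, compactly supported functions `X → R`. -/
def CompactlySupportedLC (R X : Type*) [CommRing R] [TopologicalSpace X] :
    Submodule R (X → R) where
  carrier := {f | IsLocallyConstant f ∧ HasCompactSupport f}
  add_mem' hf hg := ⟨hf.1.add hg.1, hf.2.add hg.2⟩
  zero_mem' := ⟨IsLocallyConstant.const 0, HasCompactSupport.zero⟩
  smul_mem' a _ hf := ⟨hf.1.comp (fun x => a • x), hf.2.comp_left (smul_zero a)⟩

/-- The Steinberg algebra `A_R(G)`: the module `C_c(G, R)`, with the convolution product. -/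
def SteinbergAlgebra (R G : Type*) [CommRing R] [TopologicalSpace G] : Type _ :=
  CompactlySupportedLC R G

namespace SteinbergAlgebra

section Module

variable {R G : Type*} [CommRing R] [TopologicalSpace G]

instance : AddCommGroup (SteinbergAlgebra R G) :=
  inferInstanceAs (AddCommGroup (CompactlySupportedLC R G))

instance : Module R (SteinbergAlgebra R G) :=
  inferInstanceAs (Module R (CompactlySupportedLC R G))

instance : FunLike (SteinbergAlgebra R G) G R where
  coe f := (f : CompactlySupportedLC R G).1
  coe_injective _ _ h := Subtype.ext h

@[ext] lemma ext {f g : SteinbergAlgebra R G} (h : ∀ a, f a = g a) : f = g :=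
  DFunLike.ext f g h

@[simp] lemma zero_apply (a : G) : (0 : SteinbergAlgebra R G) a = 0 := rfl
@[simp] lemma add_apply (f g : SteinbergAlgebra R G) (a : G) : (f + g) a = f a + g a := rfl
@[simp] lemma neg_apply (f : SteinbergAlgebra R G) (a : G) : (-f) a = -f a := rfl
@[simp] lemma smul_apply (x : R) (f : SteinbergAlgebra R G) (a : G) : (x • f) a = x * f a := rfl

lemma sum_apply {ι : Type*} (t : Finset ι) (F : ι → SteinbergAlgebra R G) (a : G) :
    (∑ i ∈ t, F i) a = ∑ i ∈ t, F i a := by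
  classical
  induction t using Finset.induction_on with
  | empty => simp
  | insert i t hi ih => rw [Finset.sum_insert hi, Finset.sum_insert hi, add_apply, ih]

lemma isLocallyConstant (f : SteinbergAlgebra R G) : IsLocallyConstant f := f.2.1

lemma isClopen_support (f : SteinbergAlgebra R G) : IsClopen (Function.support f) :=
  f.isLocallyConstant.isClopen_fiber 0 |>.compl

lemma isCompact_support (f : SteinbergAlgebra R G) : IsCompact (Function.support f) := by
  have h : IsCompact (closure (Function.support f)) := f.2.2
  rwa [f.isClopen_support.1.closure_eq] at h

/-- An element of the Steinberg algebra from a locally constant function that vanishes outside a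
compact set. -/
def of [T2Space G] (f : G → R) (hf : IsLocallyConstant f) (C : Set G) (hC : IsCompact C)
    (h : ∀ a, a ∉ C → f a = 0) : SteinbergAlgebra R G :=
  ⟨f, hf, HasCompactSupport.intro hC (fun a ha => h a ha)⟩

@[simp] lemma of_apply [T2Space G] (f : G → R) (hf : IsLocallyConstant f) (C : Set G)
    (hC : IsCompact C) (h : ∀ a, a ∉ C → f a = 0) (a : G) : of f hf C hC h a = f a := rfl

end Module

end SteinbergAlgebra

/-- A function that is locally constant on an open set, vanishes outside it, and has closed
support, is locally constant. -/
lemma isLocallyConstant_of_restrict {X R : Type*} [TopologicalSpace X] [Zero R] {f : X → R}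
    {W : Set X} (hW : IsOpen W) (hf : IsLocallyConstant fun x : W => f x)
    (h0 : ∀ x, x ∉ W → f x = 0) (hs : IsClosed (Function.support f)) :
    IsLocallyConstant f := by
  refine (IsLocallyConstant.iff_eventually_eq f).2 fun x => ?_
  by_cases hx : f x = 0
  · filter_upwards [hs.isOpen_compl.mem_nhds (show x ∈ (Function.support f)ᶜ by simpa using hx)]
      with y hy
    rw [hx]; simpa using hy
  · have hxW : x ∈ W := by by_contra h; exact hx (h0 x h)
    have := (IsLocallyConstant.iff_eventually_eq _).1 hf ⟨x, hxW⟩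
    rw [nhds_subtype_eq_comap, Filter.eventually_comap] at this
    filter_upwards [this, hW.mem_nhds hxW] with y hy hyW
    exact hy ⟨y, hyW⟩ rfl

namespace SteinbergAlgebra

section Restrictions

variable {R G : Type*} [CommRing R] [TopologicalSpace G]

/-- The restriction of an element of `C_c(G, R)` to a clopen set, extended by zero. -/
noncomputable def cut (D : Set G) (hD : IsClopen D) :
    SteinbergAlgebra R G →ₗ[R] SteinbergAlgebra R G where
  toFun f := ⟨D.indicator f, by
    classical
    refine ⟨(IsLocallyConstant.iff_eventually_eq _).2 fun x => ?_, ?_⟩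
    · have hf := (IsLocallyConstant.iff_eventually_eq _).1 f.isLocallyConstant x
      by_cases hx : x ∈ D
      · filter_upwards [hf, hD.2.mem_nhds hx] with y hy hyD
        rw [Set.indicator_of_mem hx, Set.indicator_of_mem hyD, hy]
      · filter_upwards [hD.1.isOpen_compl.mem_nhds hx] with y hyD
        rw [Set.indicator_of_notMem hx, Set.indicator_of_notMem hyD]
    · exact f.2.2.mono (by
        intro x hx
        simp only [Function.mem_support] at hx ⊢
        intro h; apply hx
        by_cases hxD : x ∈ D
        · rw [Set.indicator_of_mem hxD]; exact h
        · exact Set.indicator_of_notMem hxD _)⟩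
  map_add' f g := by
    ext x; exact congrFun (Set.indicator_add D (⇑f) (⇑g)) x
  map_smul' a f := by
    ext x; exact congrFun (Set.indicator_const_smul D a (⇑f)) x

open Classical in
@[simp] lemma cut_apply (D : Set G) (hD : IsClopen D) (f : SteinbergAlgebra R G) (x : G) :
    cut D hD f x = if x ∈ D then f x else 0 := by
  show D.indicator f x = _
  rw [Set.indicator_apply]

/-- For an open subset `H` of `G`, the inclusion `C_c(H, R) → C_c(G, R)` given by extension by
zero.  When `H` is a subgroupoid it identifies `A_R(H)` with a subset of `A_R(G)`. -/
noncomputable def extendByZero [T2Space G] (H : Set G) (hH : IsOpen H) :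
    SteinbergAlgebra R H →ₗ[R] SteinbergAlgebra R G where
  toFun f := ⟨Function.extend Subtype.val f 0, by
    have hin : ∀ x : H, Function.extend Subtype.val f 0 (x : G) = f x :=
      fun x => Subtype.val_injective.extend_apply _ _ x
    have hout : ∀ x, x ∉ H → Function.extend Subtype.val (⇑f) 0 x = 0 := fun x hx =>
      Function.extend_apply' _ _ _ (by rintro ⟨y, rfl⟩; exact hx y.2)
    have hK : IsCompact (Subtype.val '' Function.support f) :=
      f.isCompact_support.image continuous_subtype_val
    have hsup : Function.support (Function.extend Subtype.val (⇑f) 0)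
        = Subtype.val '' Function.support f := by
      ext x
      constructor
      · intro hx
        have hxH : x ∈ H := by by_contra h; exact hx (hout x h)
        exact ⟨⟨x, hxH⟩, by simpa [hin ⟨x, hxH⟩] using hx, rfl⟩
      · rintro ⟨y, hy, rfl⟩
        simpa [hin y] using hy
    refine ⟨isLocallyConstant_of_restrict hH ?_ hout (hsup ▸ hK.isClosed), ?_⟩
    · simpa only [hin] using f.isLocallyConstant
    · exact HasCompactSupport.intro hK fun x hx => by
        by_contra h
        exact hx (hsup ▸ h)⟩
  map_add' f g := by
    ext x
    show Function.extend Subtype.val (⇑(f + g)) 0 x =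
      Function.extend Subtype.val (⇑f) 0 x + Function.extend Subtype.val (⇑g) 0 x
    by_cases hx : x ∈ H
    · lift x to H using hx
      simp only [Subtype.val_injective.extend_apply, add_apply]
    · have : ¬ ∃ y : H, (y : G) = x := by rintro ⟨y, rfl⟩; exact hx y.2
      simp [Function.extend_apply' _ _ _ this]
  map_smul' a f := by
    ext x
    show Function.extend Subtype.val (⇑(a • f)) 0 x = a * Function.extend Subtype.val (⇑f) 0 x
    by_cases hx : x ∈ H
    · lift x to H using hx
      simp only [Subtype.val_injective.extend_apply, smul_apply]
    · have : ¬ ∃ y : H, (y : G) = x := by rintro ⟨y, rfl⟩; exact hx y.2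
      simp [Function.extend_apply' _ _ _ this]

/-- The image of extension by zero consists of the elements vanishing outside `H`. -/
lemma mem_range_extendByZero [T2Space G] (H : Set G) (hH : IsOpen H) (f : SteinbergAlgebra R G) :
    f ∈ LinearMap.range (extendByZero (R := R) H hH) ↔ ∀ x, x ∉ H → f x = 0 := by
  constructor
  · rintro ⟨k, rfl⟩ x hx
    exact Function.extend_apply' _ _ _ (by rintro ⟨y, rfl⟩; exact hx y.2)
  · intro h0
    have hsub : Function.support f ⊆ H := fun x hx => by
      by_contra h; exact hx (h0 x h)
    have hK : IsCompact ((Subtype.val : H → G) ⁻¹' Function.support f) :=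
      Topology.IsInducing.subtypeVal.isCompact_preimage_iff (by simpa using hsub)
        |>.2 f.isCompact_support
    refine ⟨of (fun x : H => f x) (f.isLocallyConstant.comp_continuous continuous_subtype_val)
      _ hK (fun x hx => by simpa using hx), ?_⟩
    ext x
    show Function.extend Subtype.val (fun x : H => f x) 0 x = f x
    by_cases hx : x ∈ H
    · lift x to H using hx
      exact Subtype.val_injective.extend_apply _ _ x
    · rw [h0 x hx]
      exact Function.extend_apply' _ _ _ (by rintro ⟨y, rfl⟩; exact hx y.2)

end Restrictions

end SteinbergAlgebra

/-! ### Convolution -/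

namespace SteinbergAlgebra

open ArrowGroupoid

section Convolution

variable {R G : Type*} [CommRing R] [ArrowGroupoid G]

/-- The convolution of two functions on `G`:
the value at `γ` is the sum of `f a * g b` over all composable pairs with `a b = γ`. -/
noncomputable def conv (f g : G → R) (γ : G) : R :=
  ∑ᶠ p : {p : G × G // ∃ h : src p.1 = rng p.2, mul p.1 p.2 h = γ}, f p.1.1 * g p.1.2

/-- For `a` with the same range as `γ`, the arrow `a⁻¹ γ`. -/
def ldiv (γ : G) (a : {a : G // rng a = rng γ}) : G := mul (inv a.1) γ ((src_inv a.1).trans a.2)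

/-- Factorizations of `γ` correspond to arrows with the same range as `γ`. -/
def factorEquiv (γ : G) : {p : G × G // ∃ h : src p.1 = rng p.2, mul p.1 p.2 h = γ} ≃
    {a : G // rng a = rng γ} where
  toFun p := ⟨p.1.1, by
    obtain ⟨h, h'⟩ := p.2
    exact (rng_mul _ _ h).symm.trans (congrArg rng h')⟩
  invFun a := ⟨(a.1, ldiv γ a), by simp [ldiv, rng_mul, rng_inv],
    mul_inv_cancel_left _ _ a.2 (by simp [rng_mul, rng_inv])⟩
  left_inv p := by
    obtain ⟨⟨a, b⟩, h, h'⟩ := p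
    subst h'
    apply Subtype.ext
    simp only [ldiv, Prod.mk.injEq, true_and]
    exact inv_mul_cancel_left a b h _
  right_inv a := rfl

lemma conv_eq (f g : G → R) (γ : G) :
    conv f g γ = ∑ᶠ a : {a : G // rng a = rng γ}, f a.1 * g (ldiv γ a) := by
  rw [conv, ← finsum_comp_equiv (factorEquiv γ).symm]
  rfl

/-- Arrows with the same range as `γ` correspond to arrows with the same range as `b⁻¹ γ`. -/
def shiftEquiv (γ : G) (b : {a : G // rng a = rng γ}) :
    {a : G // rng a = rng γ} ≃ {a : G // rng a = rng (ldiv γ b)} where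
  toFun a := ⟨ldiv a.1 ⟨b.1, b.2.trans a.2.symm⟩, by simp [ldiv, rng_mul]⟩
  invFun d := ⟨mul b.1 d.1 (by rw [d.2, ldiv, rng_mul, rng_inv]), by rw [rng_mul, b.2]⟩
  left_inv a := Subtype.ext (mul_inv_cancel_left _ _ (b.2.trans a.2.symm) _)
  right_inv d := Subtype.ext (inv_mul_cancel_left _ _ _ _)

lemma inv_mul_rev (a b : G) (h : src a = rng b) :
    inv (mul a b h) = mul (inv b) (inv a) (by rw [src_inv, rng_inv, h]) := by
  have hr : src (inv b) = rng (inv a) := by rw [src_inv, rng_inv, h]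
  have key : mul (mul a b h) (mul (inv b) (inv a) hr) (by rw [src_mul, rng_mul, rng_inv])
      = rng (mul a b h) := by
    rw [ArrowGroupoid.mul_assoc a b _ h (by rw [rng_mul, rng_inv])]
    rw [mul_congr rfl (show mul b (mul (inv b) (inv a) hr) (by rw [rng_mul, rng_inv]) = inv a from
      mul_inv_cancel_left b (inv a) (by rw [rng_inv, h]) _) _ (rng_inv a).symm, ArrowGroupoid.mul_inv, rng_mul]
  have h2 := inv_mul_cancel_left (mul a b h) (mul (inv b) (inv a) hr)
    (by rw [src_mul, rng_mul, rng_inv]) (by rw [src_inv, rng_mul (mul a b h)])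
  rw [mul_congr rfl (key.trans (src_inv _).symm) _ (rng_src _).symm, mul_src] at h2
  exact h2

lemma ldiv_shift (γ : G) (b a : {a : G // rng a = rng γ}) :
    ldiv (ldiv γ b) (shiftEquiv γ b a) = ldiv γ a := by
  have e : (shiftEquiv γ b a).1 = mul (inv b.1) a.1 ((src_inv _).trans (b.2.trans a.2.symm)) := rfl
  have h1 : src (inv a.1) = rng b.1 := by rw [src_inv, a.2, b.2]
  have e2 : inv (shiftEquiv γ b a).1 = mul (inv a.1) b.1 h1 := by
    rw [e, inv_mul_rev]; exact mul_congr rfl (ArrowGroupoid.inv_inv _) _ _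
  have e3 : src (mul (inv a.1) b.1 h1) = rng (ldiv γ b) := by
    rw [src_mul, ldiv, rng_mul, rng_inv]
  calc ldiv (ldiv γ b) (shiftEquiv γ b a) = mul (mul (inv a.1) b.1 h1) (ldiv γ b) e3 :=
        mul_congr e2 rfl _ _
    _ = mul (inv a.1) (mul b.1 (ldiv γ b) ((src_mul _ _ _).symm.trans e3)) _ :=
        ArrowGroupoid.mul_assoc _ _ _ h1 ((src_mul _ _ _).symm.trans e3)
    _ = ldiv γ a := mul_congr rfl (mul_inv_cancel_left b.1 γ b.2 _) _ _

end Convolution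

section ConvolutionTopology

variable {R G : Type*} [CommRing R] [TopologicalSpace G] [ArrowGroupoid G]

lemma continuous_r [IsAmple G] : Continuous (r : G → UnitSpace G) :=
  IsEtale.isLocalHomeomorph_r.continuous

lemma continuous_rng [IsAmple G] : Continuous (rng : G → G) :=
  continuous_subtype_val.comp continuous_r

lemma continuous_src [IsAmple G] : Continuous (src : G → G) := by
  have : (src : G → G) = rng ∘ inv := by ext a; simp [rng_inv]
  rw [this]; exact continuous_rng.comp IsEtale.continuous_inv

lemma exists_compact_bisection [IsAmple G] (K : Set G) (hKo : IsOpen K) (a : G) (ha : a ∈ K) :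
    ∃ D : Set G, IsCompact D ∧ IsOpen D ∧ a ∈ D ∧ D ⊆ K ∧
      Set.InjOn (r : G → UnitSpace G) D := by
  obtain ⟨e, hae, he⟩ := (IsEtale.isLocalHomeomorph_r (G := G)) a
  have : LocallyCompactSpace (UnitSpace G) := IsEtale.locallyCompact_units
  have hO : IsOpen (e '' (e.source ∩ K)) :=
    e.isOpen_image_of_subset_source (e.open_source.inter hKo) Set.inter_subset_left
  have haO : e a ∈ e '' (e.source ∩ K) := ⟨a, ⟨hae, ha⟩, rfl⟩
  obtain ⟨L, hL, haL, hLO⟩ := exists_compact_subset hO haO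
  obtain ⟨V, hV, haV, hVL⟩ := (IsAmple.zeroDimensional_units (G := G)).exists_subset_of_mem_open
    haL isOpen_interior
  have hVc : IsCompact V := hL.of_isClosed_subset hV.1 (hVL.trans interior_subset)
  have hVO : V ⊆ e '' (e.source ∩ K) := (hVL.trans interior_subset).trans hLO
  have hVt : V ⊆ e.target := hVO.trans (by
    rintro _ ⟨b, hb, rfl⟩; exact e.map_source hb.1)
  refine ⟨e.symm '' V, hVc.image_of_continuousOn (e.continuousOn_symm.mono hVt),
    e.symm.isOpen_image_of_subset_source hV.2 hVt, ⟨e a, haV, e.left_inv hae⟩, ?_, ?_⟩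
  · rintro _ ⟨v, hv, rfl⟩
    obtain ⟨b, hb, rfl⟩ := hVO hv
    rw [e.left_inv hb.1]; exact hb.2
  · rintro _ ⟨v, hv, rfl⟩ _ ⟨w, hw, rfl⟩ h
    rw [he, e.right_inv (hVt hv), e.right_inv (hVt hw)] at h
    rw [h]

variable [T2Space G] [IsAmple G]

lemma finite_fibre (K : Set G) (hK : IsCompact K) (u : G) : {a ∈ K | rng a = u}.Finite := by
  have hcl : IsClosed {a : G | rng a = u} := isClosed_eq continuous_rng continuous_const
  have hc : IsCompact {a ∈ K | rng a = u} := hK.inter_right hcl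
  refine hc.finite (isDiscrete_iff_forall_mem_exists_isOpen.2 fun a ha => ?_)
  obtain ⟨e, hae, he⟩ := (IsEtale.isLocalHomeomorph_r (G := G)) a
  refine ⟨e.source, e.open_source, ?_⟩
  ext b
  constructor
  · rintro ⟨hb, hb'⟩
    refine e.injOn hb hae ?_
    rw [← he]
    exact Subtype.ext (hb'.2.trans ha.2.symm)
  · rintro rfl; exact ⟨hae, ha⟩

lemma finite_support_conv (f : SteinbergAlgebra R G) (γ : G)
    (k : {a : G // rng a = rng γ} → R) :
    (Function.support fun a : {a : G // rng a = rng γ} => f a.1 * k a).Finite := by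
  refine Set.Finite.of_finite_image (f := Subtype.val)
    ((finite_fibre _ f.isCompact_support (rng γ)).subset ?_) Subtype.val_injective.injOn
  rintro _ ⟨a, ha, rfl⟩
  exact ⟨fun h => ha (by simp [h]), a.2⟩

lemma conv_add_left (f f' g : SteinbergAlgebra R G) (γ : G) :
    conv (f + f' : SteinbergAlgebra R G) g γ = conv f g γ + conv f' g γ := by
  simp only [conv_eq, add_apply, add_mul]
  exact finsum_add_distrib (finite_support_conv f γ _) (finite_support_conv f' γ _)

lemma conv_add_right (f g g' : SteinbergAlgebra R G) (γ : G) :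
    conv f (g + g' : SteinbergAlgebra R G) γ = conv f g γ + conv f g' γ := by
  simp only [conv_eq, add_apply, mul_add]
  exact finsum_add_distrib (finite_support_conv f γ _) (finite_support_conv f γ _)

lemma conv_support (f g : SteinbergAlgebra R G) : ∃ C : Set G, IsCompact C ∧
    ∀ γ, γ ∉ C → conv f g γ = 0 := by
  have hcl : IsClosed {p : G × G | src p.1 = rng p.2} :=
    isClosed_eq (continuous_src.comp continuous_fst) (continuous_rng.comp continuous_snd)
  have hc : IsCompact ((Subtype.val : {p : G × G // src p.1 = rng p.2} → G × G) ⁻¹'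
      (Function.support f ×ˢ Function.support g)) :=
    hcl.isClosedEmbedding_subtypeVal.isCompact_preimage
      (f.isCompact_support.prod g.isCompact_support)
  refine ⟨_, hc.image IsEtale.continuous_mul, fun γ hγ => ?_⟩
  refine finsum_eq_zero_of_forall_eq_zero fun p => ?_
  obtain ⟨⟨a, b⟩, h, h'⟩ := p
  by_contra hne
  exact hγ ⟨⟨(a, b), h⟩, ⟨fun h0 => hne (by simp [h0]), fun h0 => hne (by simp [h0])⟩, h'⟩

/-- Local constancy of a convolution when the first factor lives on a compact open set on which
the range map is injective. -/
lemma conv_lc_of_injOn (f g : SteinbergAlgebra R G) (D : Set G) (hD : IsCompact D)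
    (hDo : IsOpen D) (hinj : Set.InjOn (r : G → UnitSpace G) D) (hfD : ∀ a, a ∉ D → f a = 0) :
    IsLocallyConstant (conv f g) := by
  have hemb : Topology.IsOpenEmbedding (fun a : D => r a.1) :=
    .of_continuous_injective_isOpenMap (continuous_r.comp continuous_subtype_val)
      (fun a b h => Subtype.ext (hinj a.2 b.2 h))
      (IsEtale.isLocalHomeomorph_r.isOpenMap.comp hDo.isOpenMap_subtype_val)
  let W : Set G := r ⁻¹' Set.range (fun a : D => r a.1)
  have hWo : IsOpen W := hemb.isOpen_range.preimage continuous_r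
  have hWc : IsClosed W := by
    have : CompactSpace D := isCompact_iff_compactSpace.1 hD
    exact (isCompact_range hemb.continuous).isClosed.preimage continuous_r
  have h0 : ∀ γ, γ ∉ W → conv f g γ = 0 := by
    intro γ hγ
    rw [conv_eq]
    refine finsum_eq_zero_of_forall_eq_zero fun a => ?_
    rw [hfD a.1 (fun ha => hγ ⟨⟨a.1, ha⟩, Subtype.ext a.2⟩), zero_mul]
  let σ := hemb.isEmbedding.toHomeomorph.symm
  let α : W → D := fun γ => σ ⟨r γ.1, γ.2⟩
  have hα : Continuous α :=
    σ.continuous.comp ((continuous_r.comp continuous_subtype_val).subtype_mk _)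
  have hrα : ∀ γ : W, rng (α γ).1 = rng γ.1 := fun γ =>
    congrArg (fun x => (x : UnitSpace G).1)
      (congrArg Subtype.val (hemb.isEmbedding.toHomeomorph.apply_symm_apply ⟨r γ.1, γ.2⟩))
  let β : W → G := fun γ => ldiv γ.1 ⟨(α γ).1, hrα γ⟩
  have hβ : Continuous β := by
    have h1 : Continuous fun γ : W => ((inv (α γ).1, γ.1) : G × G) :=
      (IsEtale.continuous_inv.comp (continuous_subtype_val.comp hα)).prodMk
        continuous_subtype_val
    have h2 : ∀ γ : W, src (inv (α γ).1) = rng γ.1 := fun γ => (src_inv _).trans (hrα γ)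
    exact (IsEtale.continuous_mul (G := G)).comp
      (h1.subtype_mk (p := fun p : G × G => src p.1 = rng p.2) h2)
  have hval : ∀ γ : W, conv f g γ = f (α γ).1 * g (β γ) := by
    intro γ
    rw [conv_eq]
    refine finsum_eq_single _ (⟨(α γ).1, hrα γ⟩ : {a : G // rng a = rng γ.1}) fun a ha => ?_
    rw [hfD a.1 (fun haD => ha ?_), zero_mul]
    exact Subtype.ext (hinj haD (α γ).2 (Subtype.ext (a.2.trans (hrα γ).symm)))
  have hlc : IsLocallyConstant fun γ : W => conv f g γ := by
    simp only [hval]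
    exact (f.isLocallyConstant.comp_continuous (continuous_subtype_val.comp hα)).mul
      (g.isLocallyConstant.comp_continuous hβ)
  refine (IsLocallyConstant.iff_eventually_eq _).2 fun x => ?_
  by_cases hx : x ∈ W
  · have := (IsLocallyConstant.iff_eventually_eq _).1 hlc ⟨x, hx⟩
    rw [nhds_subtype_eq_comap, Filter.eventually_comap] at this
    filter_upwards [this, hWo.mem_nhds hx] with y hy hyW
    exact hy ⟨y, hyW⟩ rfl
  · filter_upwards [hWc.isOpen_compl.mem_nhds hx] with y hy
    rw [h0 x hx, h0 y hy]

lemma conv_lc (f g : SteinbergAlgebra R G) : IsLocallyConstant (conv f g) := by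
  classical
  have key : ∀ (t : Set (Set G)), t.Finite →
      (∀ D ∈ t, IsCompact D ∧ IsOpen D ∧ Set.InjOn (r : G → UnitSpace G) D) →
      ∀ f : SteinbergAlgebra R G, Function.support f ⊆ ⋃₀ t → IsLocallyConstant (conv f g) := by
    intro t ht
    induction t, ht using Set.Finite.induction_on with
    | empty =>
      intro _ f hf
      have : f = 0 := by
        ext a; by_contra h; simpa using hf h
      subst this
      have : conv (0 : SteinbergAlgebra R G) g = fun _ => (0 : R) := by
        ext γ; simp [conv]
      rw [this]; exact IsLocallyConstant.const 0
    | @insert D t _ _ ih =>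
      intro hD f hf
      obtain ⟨hDc, hDo, hDi⟩ := hD D (Set.mem_insert _ _)
      have hcl : IsClopen D := ⟨hDc.isClosed, hDo⟩
      have hsplit : f = cut D hcl f + cut Dᶜ hcl.compl f := by
        ext a; by_cases ha : a ∈ D <;> simp [ha]
      have : conv f g = conv (cut D hcl f) g + conv (cut Dᶜ hcl.compl f) g := by
        ext γ
        conv_lhs => rw [hsplit]
        exact conv_add_left _ _ _ _
      rw [this]
      refine (conv_lc_of_injOn _ g D hDc hDo hDi fun a ha => by simp [ha]).add
        (ih (fun E hE => hD E (Set.mem_insert_of_mem _ hE)) _ fun a ha => ?_)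
      by_cases haD : a ∈ D
      · exact absurd (by simp [haD]) ha
      · have : f a ≠ 0 := by simpa [haD] using ha
        simpa [haD] using hf this
  choose! D hDc hDo haD _ hDi using exists_compact_bisection (Function.support f) f.isClopen_support.2
  obtain ⟨t, ht, hcov⟩ := f.isCompact_support.elim_nhds_subcover D
    (fun a ha => (hDo a ha).mem_nhds (haD a ha))
  refine key (D '' t) (t.finite_toSet.image _) ?_ f ?_
  · rintro _ ⟨a, ha, rfl⟩
    exact ⟨hDc a (ht a ha), hDo a (ht a ha), hDi a (ht a ha)⟩
  · simpa using hcov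

noncomputable instance : Mul (SteinbergAlgebra R G) where
  mul f g := ⟨conv f g, conv_lc f g, by
    obtain ⟨C, hC, h⟩ := conv_support f g
    exact HasCompactSupport.intro hC h⟩

/-- The product of the Steinberg algebra is convolution. -/
lemma mul_apply (f g : SteinbergAlgebra R G) (γ : G) : (f * g) γ = conv f g γ := rfl

lemma conv_assoc (f g h : SteinbergAlgebra R G) : f * g * h = f * (g * h) := by
  ext γ
  have hA := finite_support_conv (f * g) γ fun a => h (ldiv γ a)
  have hB := finite_fibre _ f.isCompact_support (rng γ)
  let B : Set {a : G // rng a = rng γ} := Function.support fun b => f b.1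
  have hBf : B.Finite := by simpa using finite_support_conv f γ fun _ => (1 : R)
  -- the arrows `a = b d` with `b` in the support of `f` and `d` in the support of `g`
  let A : Set {a : G // rng a = rng γ} :=
    ⋃ b ∈ B, (shiftEquiv γ b) ⁻¹' (Function.support fun d => g d.1)
  have hAf : A.Finite := hBf.biUnion fun b _ =>
    Set.Finite.preimage (shiftEquiv γ b).injective.injOn
      (by simpa using finite_support_conv g (ldiv γ b) fun _ => (1 : R))
  have h1 : ∀ a : {a : G // rng a = rng γ}, (f * g) a.1 =
      ∑ b ∈ hBf.toFinset, f b.1 * g (shiftEquiv γ b a).1 := by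
    intro a
    rw [mul_apply, conv_eq]
    let e : {b : G // rng b = rng a.1} ≃ {b : G // rng b = rng γ} :=
      Equiv.subtypeEquivRight fun b => by rw [a.2]
    rw [← finsum_comp_equiv e.symm]
    refine finsum_eq_sum_of_support_subset _ fun b hb => ?_
    simp only [Set.Finite.coe_toFinset]
    exact fun h0 => hb (by
      show f b.1 * _ = 0
      rw [show f b.1 = 0 from h0, zero_mul])
  have h2 : ∀ b : {a : G // rng a = rng γ}, b ∈ B → (g * h) (ldiv γ b) =
      ∑ a ∈ hAf.toFinset, g (shiftEquiv γ b a).1 * h (ldiv γ a) := by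
    intro b hb
    rw [mul_apply, conv_eq, ← finsum_comp_equiv (shiftEquiv γ b)]
    simp only [ldiv_shift]
    refine finsum_eq_sum_of_support_subset _ fun a ha => ?_
    simp only [Set.Finite.coe_toFinset]
    refine Set.mem_biUnion hb fun h0 => ha ?_
    show g _ * _ = 0
    rw [show g (shiftEquiv γ b a).1 = 0 from h0, zero_mul]
  have hL : (f * g * h) γ = ∑ a ∈ hAf.toFinset, (f * g) a.1 * h (ldiv γ a) := by
    rw [mul_apply, conv_eq]
    refine finsum_eq_sum_of_support_subset _ fun a ha => ?_
    simp only [Set.Finite.coe_toFinset]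
    by_contra hn
    refine ha ?_
    show (f * g) a.1 * _ = 0
    rw [h1, Finset.sum_eq_zero, zero_mul]
    intro b hb
    have hb' : b ∈ B := by simpa using hb
    have : g (shiftEquiv γ b a).1 = 0 := by
      by_contra h0
      exact hn (Set.mem_biUnion hb' h0)
    rw [this, mul_zero]
  have hR : (f * (g * h)) γ = ∑ b ∈ hBf.toFinset, f b.1 * (g * h) (ldiv γ b) := by
    rw [mul_apply, conv_eq]
    refine finsum_eq_sum_of_support_subset _ fun b hb => ?_
    simp only [Set.Finite.coe_toFinset]
    exact fun h0 => hb (by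
      show f b.1 * _ = 0
      rw [show f b.1 = 0 from h0, zero_mul])
  rw [hL, hR]
  simp only [h1, Finset.sum_mul]
  rw [Finset.sum_comm]
  refine Finset.sum_congr rfl fun b hb => ?_
  rw [h2 b (by simpa using hb), Finset.mul_sum]
  exact Finset.sum_congr rfl fun a _ => _root_.mul_assoc _ _ _

noncomputable instance : NonUnitalRing (SteinbergAlgebra R G) where
  left_distrib f g h := by ext γ; exact conv_add_right f g h γ
  right_distrib f g h := by ext γ; exact conv_add_left f g h γ
  zero_mul f := by ext γ; simp [mul_apply, conv]
  mul_zero f := by ext γ; simp [mul_apply, conv]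
  mul_assoc := conv_assoc

instance : IsScalarTower R (SteinbergAlgebra R G) (SteinbergAlgebra R G) where
  smul_assoc x f g := by
    ext γ
    simp only [smul_eq_mul, mul_apply, smul_apply, conv_eq, _root_.mul_assoc]
    exact (smul_finsum' x (finite_support_conv f γ _)).symm

instance : SMulCommClass R (SteinbergAlgebra R G) (SteinbergAlgebra R G) where
  smul_comm x f g := by
    ext γ
    simp only [smul_eq_mul, mul_apply, smul_apply, conv_eq, mul_left_comm _ x]
    exact smul_finsum' x (finite_support_conv f γ _)

end ConvolutionTopology

end SteinbergAlgebra

/-! ### Gradings and graded ideals -/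

/-- A locally constant cocycle on `G` with values in the (discrete) group `Γ`. -/
structure LCCocycle (G Γ : Type*) [TopologicalSpace G] [ArrowGroupoid G] [Group Γ] where
  toFun : G → Γ
  isCocycle : ArrowGroupoid.IsCocycle toFun
  isLocallyConstant : IsLocallyConstant toFun

namespace LCCocycle

variable {G Γ : Type*} [TopologicalSpace G] [ArrowGroupoid G] [Group Γ]

/-- The subgroupoid `c⁻¹(e)` of `G`. -/
abbrev kernel (c : LCCocycle G Γ) : ArrowGroupoid.Sub G :=
  ArrowGroupoid.kernel c.toFun c.isCocycle

lemma isClopen_fibre (c : LCCocycle G Γ) (g : Γ) : IsClopen (c.toFun ⁻¹' {g}) :=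
  c.isLocallyConstant.isClopen_fiber g

end LCCocycle

namespace SteinbergAlgebra

section Grading

variable {R G Γ : Type*} [CommRing R] [TopologicalSpace G] [ArrowGroupoid G] [Group Γ]

/-- The homogeneous submodule of degree `g`: the elements vanishing outside `c⁻¹(g)`. -/
def homogeneous (R : Type*) [CommRing R] (c : LCCocycle G Γ) (g : Γ) :
    Submodule R (SteinbergAlgebra R G) where
  carrier := {f | ∀ a, c.toFun a ≠ g → f a = 0}
  add_mem' hf hk a ha := by rw [add_apply, hf a ha, hk a ha, add_zero]
  zero_mem' _ _ := rfl
  smul_mem' x f hf a ha := by rw [smul_apply, hf a ha, mul_zero]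

/-- The projection onto the homogeneous submodule of degree `g`. -/
noncomputable def component (c : LCCocycle G Γ) (g : Γ) :
    SteinbergAlgebra R G →ₗ[R] SteinbergAlgebra R G :=
  cut (c.toFun ⁻¹' {g}) (c.isClopen_fibre g)

open Classical in
@[simp] lemma component_apply (c : LCCocycle G Γ) (g : Γ) (f : SteinbergAlgebra R G) (a : G) :
    component c g f a = if c.toFun a = g then f a else 0 :=
  cut_apply _ _ f a

lemma component_mem (c : LCCocycle G Γ) (g : Γ) (f : SteinbergAlgebra R G) :
    component c g f ∈ homogeneous R c g := fun a ha => by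
  rw [component_apply, if_neg ha]

lemma component_of_mem (c : LCCocycle G Γ) {g : Γ} {f : SteinbergAlgebra R G}
    (hf : f ∈ homogeneous R c g) : component c g f = f := by
  ext a
  by_cases ha : c.toFun a = g
  · simp [ha]
  · simp [ha, hf a ha]

lemma component_of_mem_of_ne (c : LCCocycle G Γ) {g k : Γ} (hgk : g ≠ k)
    {f : SteinbergAlgebra R G} (hf : f ∈ homogeneous R c k) : component c g f = 0 := by
  ext a
  by_cases ha : c.toFun a = g
  · simp [ha, hf a (fun h => hgk (ha.symm.trans h))]
  · simp [ha]

lemma finite_degrees (c : LCCocycle G Γ) (f : SteinbergAlgebra R G) :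
    (c.toFun '' Function.support f).Finite := by
  let : TopologicalSpace Γ := ⊥
  have : DiscreteTopology Γ := ⟨rfl⟩
  exact (f.isCompact_support.image c.isLocallyConstant.continuous).finite_of_discrete

/-- An element is the sum of its homogeneous components. -/
lemma sum_component (c : LCCocycle G Γ) (f : SteinbergAlgebra R G) :
    ∑ g ∈ (finite_degrees c f).toFinset, component c g f = f := by
  classical
  ext a
  rw [sum_apply]
  simp only [component_apply, Finset.sum_ite_eq]
  split_ifs with h
  · rfl
  · by_contra hne
    exact h (by simpa using ⟨a, fun h0 => hne h0.symm, rfl⟩)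

open Classical in
/-- For a subgroup that contains the homogeneous components of its elements, and only for such a
subgroup, the intersections with the homogeneous submodules form a direct sum decomposition. -/
lemma isInternal_iff (c : LCCocycle G Γ) (J : AddSubgroup (SteinbergAlgebra R G)) :
    DirectSum.IsInternal (fun g : Γ => (homogeneous R c g).toAddSubgroup.comap J.subtype) ↔
      ∀ f ∈ J, ∀ g, component c g f ∈ J := by
  let B : Γ → AddSubgroup J := fun g => (homogeneous R c g).toAddSubgroup.comap J.subtype
  have hcomp : ∀ (x : DirectSum Γ fun g => B g) (g : Γ),
      component c g ((DirectSum.coeAddMonoidHom B x : J) : SteinbergAlgebra R G)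
        = ((x g : J) : SteinbergAlgebra R G) := by
    intro x g
    induction x using DirectSum.induction_on with
    | zero => simp
    | of k y =>
      rw [DirectSum.coeAddMonoidHom_of]
      by_cases h : g = k
      · subst h
        rw [DirectSum.of_eq_same]
        exact component_of_mem c y.2
      · rw [DirectSum.of_eq_of_ne _ _ _ h]
        exact component_of_mem_of_ne c h y.2
    | add x y hx hy =>
      rw [map_add, AddSubgroup.coe_add, map_add, hx, hy]; rfl
  constructor
  · intro h f hf g
    obtain ⟨x, hx⟩ := h.2 ⟨f, hf⟩
    have := hcomp x g
    rw [hx] at this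
    rw [this]
    exact (x g : J).2
  · intro h
    refine ⟨fun x y hxy => ?_, fun f => ?_⟩
    · refine DFinsupp.ext fun g => Subtype.ext (Subtype.ext ?_)
      rw [← hcomp x g, ← hcomp y g]
      exact congrArg (fun z : J => component c g (z : SteinbergAlgebra R G)) hxy
    · refine ⟨∑ g ∈ (finite_degrees c f.1).toFinset,
        DirectSum.of (fun g => B g) g ⟨⟨component c g f.1, h f.1 f.2 g⟩, component_mem c g f.1⟩, ?_⟩
      rw [map_sum]
      refine Subtype.ext ?_
      rw [AddSubgroup.val_finsetSum]
      exact (Finset.sum_congr rfl fun g _ =>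
        congrArg Subtype.val (DirectSum.coeAddMonoidHom_of B g _)).trans (sum_component c f.1)

variable [T2Space G] [ArrowGroupoid.IsAmple G]

/-- The homogeneous submodules are compatible with the product. -/
lemma homogeneous_mul_mem (c : LCCocycle G Γ) (g k : Γ) (f f' : SteinbergAlgebra R G)
    (hf : f ∈ homogeneous R c g) (hf' : f' ∈ homogeneous R c k) :
    f * f' ∈ homogeneous R c (g * k) := by
  intro a ha
  rw [mul_apply]
  refine finsum_eq_zero_of_forall_eq_zero fun p => ?_
  obtain ⟨⟨x, y⟩, h, h'⟩ := p
  by_cases hx : c.toFun x = g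
  · by_cases hy : c.toFun y = k
    · exact absurd (by rw [← h', c.isCocycle, hx, hy]) ha
    · simp [hf' y hy]
  · simp [hf x hx]

open Classical in
/-- An ideal `J` is graded if it is the direct sum of its intersections with the homogeneous
submodules. -/
def IsGraded (c : LCCocycle G Γ) (J : TwoSidedIdeal (SteinbergAlgebra R G)) : Prop :=
  DirectSum.IsInternal (fun g : Γ =>
    (homogeneous R c g).toAddSubgroup.comap (AddSubgroup.ofClass J).subtype)

lemma isGraded_iff (c : LCCocycle G Γ) (J : TwoSidedIdeal (SteinbergAlgebra R G)) :
    IsGraded c J ↔ ∀ f ∈ J, ∀ g, component c g f ∈ J :=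
  isInternal_iff c (AddSubgroup.ofClass J)

/-- The graded ideals of the Steinberg algebra, ordered by inclusion. -/
abbrev GradedIdeal (R : Type*) [CommRing R] (c : LCCocycle G Γ) : Type _ :=
  {J : TwoSidedIdeal (SteinbergAlgebra R G) // IsGraded c J}

/-- Graded ideals form a lattice, the join being the sum and the meet the intersection. -/
noncomputable instance (c : LCCocycle G Γ) : Lattice (GradedIdeal R c) :=
  Subtype.lattice
    (fun I J hI hJ => (isGraded_iff c _).2 fun f hf g => by
      obtain ⟨x, hx, y, hy, rfl⟩ := TwoSidedIdeal.mem_sup.1 hf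
      rw [map_add]
      exact TwoSidedIdeal.mem_sup.2 ⟨_, (isGraded_iff c I).1 hI x hx g, _,
        (isGraded_iff c J).1 hJ y hy g, rfl⟩)
    (fun I J hI hJ => (isGraded_iff c _).2 fun f hf g =>
      (TwoSidedIdeal.mem_inf _).2 ⟨(isGraded_iff c I).1 hI f ((TwoSidedIdeal.mem_inf _).1 hf).1 g,
        (isGraded_iff c J).1 hJ f ((TwoSidedIdeal.mem_inf _).1 hf).2 g⟩)

end Grading

section Restriction

variable {G : Type*} [TopologicalSpace G] [ArrowGroupoid G]

variable (G) in
/-- The open invariant subsets of the unit space, ordered by inclusion. -/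
abbrev OpenInvariant : Type _ :=
  {U : TopologicalSpace.Opens (ArrowGroupoid.UnitSpace G) //
    ArrowGroupoid.Invariant (U : Set (ArrowGroupoid.UnitSpace G))}

/-- Open invariant sets form a lattice, under union and intersection. -/
instance : Lattice (OpenInvariant G) :=
  Subtype.lattice (fun _ _ hU hV a => or_congr (hU a) (hV a))
    (fun _ _ hU hV a => and_congr (hU a) (hV a))

/-- The restriction `G|_U` to an open invariant set `U` of units. -/
abbrev OpenInvariant.restrict (U : OpenInvariant G) : ArrowGroupoid.Sub G :=
  ArrowGroupoid.restrict (U.1 : Set (ArrowGroupoid.UnitSpace G)) U.2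

lemma OpenInvariant.isOpen_restrict [ArrowGroupoid.IsAmple G] (U : OpenInvariant G) : IsOpen U.restrict.carrier :=
  U.1.isOpen.preimage continuous_r

variable [T2Space G] [ArrowGroupoid.IsAmple G]

/-- The algebra `A_R(G|_U)`, seen inside `A_R(G)` by extension by zero. -/
noncomputable def ofRestrict (R : Type*) [CommRing R] (U : OpenInvariant G) :
    Submodule R (SteinbergAlgebra R G) :=
  LinearMap.range (extendByZero (R := R) U.restrict.carrier U.isOpen_restrict)

end Restriction

end SteinbergAlgebra

/-! The ideal `A(G|_U)` determines `U`: it contains `1_D` for every compact open set `D` of arrows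
with range in `U`. Conversely, let `U_J` be the open invariant set of units at which some element of
`J` supported on the unit space does not vanish. By compactness `J` has an element equal to `1` on
any given compact subset of `U_J`, hence `A(G|_{U_J}) ⊆ J`.

For the other inclusion, suppose `f ∈ J` has degree `e` and does not vanish at a unit outside
`U_J`. Over the closed invariant complement `C` of `U_J`, effectiveness of `c⁻¹(e)` makes the set
of units in `C` with a nontrivial isotropy arrow in the support of `f` nowhere dense. Hence some
compact open set `D` of units, on which `f` is a nonzero constant, meets `C`, while no non-unit
arrow of the support of `f` goes from `D` to `D`. Then `1_D f 1_D` is a nonzero multiple of `1_D`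
in `J`, so `D ⊆ U_J`, a contradiction. An element of degree `g` is moved to degree `e` by
multiplying it with `1_D` for a bisection `D` of degree `g⁻¹`. -/

namespace ArrowGroupoid

section Algebraic

variable {G : Type*} [ArrowGroupoid G]

lemma rng_of_src_eq {x : G} (hx : src x = x) : rng x = x := by
  rw [← hx, rng_src]

lemma mul_of_src_eq_right {x y : G} (hy : src y = y) (h : src x = rng y) : mul x y h = x :=
  (mul_congr rfl ((rng_of_src_eq hy).symm.trans h.symm) h (rng_src x).symm).trans (mul_src x)

lemma mul_left_cancel {a b b' : G} {h : src a = rng b} {h' : src a = rng b'}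
    (hbb' : mul a b h = mul a b' h') : b = b' := by
  have hinv : src (inv a) = rng (mul a b h) := by rw [src_inv, rng_mul]
  rw [← inv_mul_cancel_left a b h hinv, ← inv_mul_cancel_left a b' h' (hbb' ▸ hinv)]
  exact mul_congr rfl hbb' _ _

lemma r_eq_iff {a b : G} : r a = r b ↔ rng a = rng b := Subtype.ext_iff

lemma s_eq_iff {a b : G} : s a = s b ↔ src a = src b := Subtype.ext_iff

lemma r_inv (a : G) : r (inv a) = s a := Subtype.ext (rng_inv a)

lemma s_inv (a : G) : s (inv a) = r a := Subtype.ext (src_inv a)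

lemma r_coe (x : UnitSpace G) : r (x : G) = x := Subtype.ext (rng_of_src_eq x.2)

lemma IsCocycle.map_inv {Γ : Type*} [Group Γ] {c : G → Γ} (hc : IsCocycle c) (a : G) :
    c (inv a) = (c a)⁻¹ := by
  have h := hc (inv a) a (src_inv a)
  rw [inv_mul, ← rng_src, hc.map_rng] at h
  exact eq_inv_of_mul_eq_one_left h.symm

/-- A bisection of `G`: a set of arrows on which both the range and the source are injective. -/
structure IsBisection (D : Set G) : Prop where
  injOn_r : Set.InjOn (r : G → UnitSpace G) D
  injOn_s : Set.InjOn (s : G → UnitSpace G) D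

end Algebraic

section Topological

variable {G : Type*} [TopologicalSpace G] [ArrowGroupoid G]

lemma isOpen_units [IsEtale G] : IsOpen {x : G | src x = x} := by
  have hr : IsLocalHomeomorph (r ∘ ((↑) : UnitSpace G → G)) := by
    rw [show r ∘ ((↑) : UnitSpace G → G) = id from funext r_coe]
    exact (Homeomorph.refl _).isLocalHomeomorph
  have hval : IsLocalHomeomorph (Subtype.val : UnitSpace G → G) :=
    .of_comp hr IsEtale.isLocalHomeomorph_r continuous_subtype_val
  simpa only [Subtype.range_coe_subtype] using hval.isOpenMap.isOpen_range

lemma isOpenMap_inv [IsEtale G] : IsOpenMap (inv : G → G) :=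
  .of_inverse IsEtale.continuous_inv inv_inv inv_inv

variable [IsAmple G]

open SteinbergAlgebra (continuous_r continuous_rng continuous_src exists_compact_bisection)

lemma continuous_s : Continuous (s : G → UnitSpace G) :=
  continuous_src.subtype_mk _

lemma isClopen_units [T2Space G] : IsClopen {x : G | src x = x} :=
  ⟨isClosed_eq continuous_src continuous_id, isOpen_units⟩

lemma isClosed_iso [T2Space G] : IsClosed (Iso G) :=
  isClosed_eq continuous_rng continuous_src

lemma exists_compactOpens_isBisection {O : Set G} (hO : IsOpen O) {a : G} (ha : a ∈ O) :
    ∃ D : TopologicalSpace.CompactOpens G, a ∈ D ∧ (D : Set G) ⊆ O ∧ IsBisection (D : Set G) := by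
  obtain ⟨E, -, hE, haE, -, hEr⟩ := exists_compact_bisection Set.univ isOpen_univ (inv a) trivial
  obtain ⟨D, hDc, hDo, haD, hDO, hDr⟩ := exists_compact_bisection (O ∩ inv ⁻¹' E)
    (hO.inter (hE.preimage IsEtale.continuous_inv)) a ⟨ha, haE⟩
  have hDs : Set.InjOn (s : G → UnitSpace G) D := fun x hx y hy hxy => by
    have hinv : inv x = inv y := hEr (hDO hx).2 (hDO hy).2 (by rwa [r_inv, r_inv])
    rw [← inv_inv x, hinv, inv_inv]
  exact ⟨⟨⟨D, hDc⟩, hDo⟩, haD, fun x hx => (hDO hx).1, hDr, hDs⟩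

end Topological

end ArrowGroupoid

lemma isNowhereDense_union {X : Type*} [TopologicalSpace X] {s t : Set X}
    (hs : IsNowhereDense s) (ht : IsNowhereDense t) : IsNowhereDense (s ∪ t) := by
  rw [IsNowhereDense, closure_union]
  exact (interior_union_isClosed_of_interior_empty isClosed_closure ht).trans hs

namespace ArrowGroupoid

section Effectivity

variable {G : Type*} [TopologicalSpace G] [ArrowGroupoid G] {S : Sub G} {C : Set (UnitSpace G)}

lemma StronglyEffective.inter_subset_units (hS : StronglyEffective S.carrier)
    (hC : Invariant C) (hCc : IsClosed C) {O : Set G} (hO : IsOpen O)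
    (hiso : O ∩ (S.carrier ∩ r ⁻¹' C) ⊆ Iso G) :
    O ∩ (S.carrier ∩ r ⁻¹' C) ⊆ {x | src x = x} := by
  let ι : UnitSpace S.carrier → UnitSpace G := fun u => ⟨u.1.1, congrArg Subtype.val u.2⟩
  have hι : Continuous ι := (continuous_subtype_val.comp continuous_subtype_val).subtype_mk _
  have hinv : Invariant (ι ⁻¹' C) := fun a => hC a.1
  have hint : {x : (restrict (ι ⁻¹' C) hinv).carrier | (x : S.carrier).1 ∈ O} ⊆
      interior (Iso (restrict (ι ⁻¹' C) hinv).carrier) :=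
    interior_maximal (fun x hx => Subtype.ext (Subtype.ext (hiso ⟨hx, x.1.2, x.2⟩)))
      (hO.preimage (continuous_subtype_val.comp continuous_subtype_val))
  rw [hS (ι ⁻¹' C) hinv (hCc.preimage hι)] at hint
  rintro b ⟨hbO, hbS, hbC⟩
  exact congrArg (fun x => x.1.1) (@hint ⟨⟨b, hbS⟩, hbC⟩ hbO)

open SteinbergAlgebra (continuous_r)

variable [T2Space G] [IsAmple G]

lemma StronglyEffective.isNowhereDense_of_isBisection (hS : StronglyEffective S.carrier)
    (hC : Invariant C) (hCc : IsClosed C) {D : TopologicalSpace.CompactOpens G}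
    (hD : IsBisection (D : Set G)) (hDS : (D : Set G) ⊆ S.carrier)
    (hDu : Disjoint (D : Set G) {x | src x = x}) :
    IsNowhereDense ((↑) ⁻¹' (r '' (↑D ∩ Iso G)) : Set C) := by
  have hclosed : IsClosed (r '' (↑D ∩ Iso G) : Set (UnitSpace G)) :=
    ((D.isCompact.inter_right isClosed_iso).image continuous_r).isClosed
  rw [(hclosed.preimage continuous_subtype_val).isNowhereDense_iff,
    Set.eq_empty_iff_forall_notMem]
  intro y hy
  obtain ⟨_, hsub, ⟨W, hW, rfl⟩, hyW⟩ := mem_interior.1 hy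
  obtain ⟨a, ⟨haD, -⟩, hay⟩ := interior_subset hy
  have hiso : (↑D ∩ r ⁻¹' W) ∩ (S.carrier ∩ r ⁻¹' C) ⊆ Iso G := by
    rintro b ⟨⟨hbD, hbW⟩, -, hbC⟩
    obtain ⟨b', ⟨hb'D, hb'⟩, hbb'⟩ := @hsub ⟨r b, hbC⟩ hbW
    rwa [← hD.injOn_r hb'D hbD hbb']
  have hau := hS.inter_subset_units hC hCc (D.isOpen.inter (hW.preimage continuous_r)) hiso
    ⟨⟨haD, Set.mem_preimage.2 (hay ▸ hyW)⟩, hDS haD, Set.mem_preimage.2 (hay ▸ y.2)⟩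
  exact Set.disjoint_left.1 hDu haD hau

lemma StronglyEffective.isNowhereDense (hS : StronglyEffective S.carrier)
    (hC : Invariant C) (hCc : IsClosed C) {B : TopologicalSpace.CompactOpens G}
    (hBS : (B : Set G) ⊆ S.carrier) (hBu : Disjoint (B : Set G) {x | src x = x}) :
    IsNowhereDense ((↑) ⁻¹' (r '' (↑B ∩ Iso G)) : Set C) := by
  refine B.isCompact.induction_on
    (p := fun T => IsNowhereDense ((↑) ⁻¹' (r '' (T ∩ Iso G)) : Set C)) ?_ ?_ ?_ fun a ha => ?_
  · simp
  · exact fun _ _ hTT' => .mono (by gcongr)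
  · intro T T' hT hT'
    rw [Set.union_inter_distrib_right, Set.image_union, Set.preimage_union]
    exact isNowhereDense_union hT hT'
  · obtain ⟨D, haD, hDB, hD⟩ := exists_compactOpens_isBisection B.isOpen ha
    exact ⟨D, mem_nhdsWithin_of_mem_nhds (D.isOpen.mem_nhds haD),
      hS.isNowhereDense_of_isBisection hC hCc hD (hDB.trans hBS) (hBu.mono_left hDB)⟩

lemma StronglyEffective.exists_isOpen_separating (hS : StronglyEffective S.carrier)
    (hC : Invariant C) (hCc : IsClosed C) {B : TopologicalSpace.CompactOpens G}
    (hBS : (B : Set G) ⊆ S.carrier) (hBu : Disjoint (B : Set G) {x | src x = x})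
    {W : Set (UnitSpace G)} (hW : IsOpen W) (hWC : (W ∩ C).Nonempty) :
    ∃ V ⊆ W, IsOpen V ∧ (V ∩ C).Nonempty ∧ ∀ a ∈ B, r a ∈ V → s a ∉ V := by
  obtain ⟨x, hxW, hxC⟩ := hWC
  have hdense : Dense ((↑) ⁻¹' (r '' (↑B ∩ Iso G)) : Set C)ᶜ :=
    (interior_eq_empty_iff_dense_compl.1 (hS.isNowhereDense hC hCc hBS hBu)).mono
      (Set.compl_subset_compl.2 subset_closure)
  obtain ⟨⟨y, hyC⟩, hyW, hy⟩ := hdense.inter_open_nonempty _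
    (hW.preimage continuous_subtype_val) ⟨⟨x, hxC⟩, hxW⟩
  have hclosed : IsClosed ((fun a => (r a, s a)) '' (B : Set G)) :=
    (B.isCompact.image (continuous_r.prodMk continuous_s)).isClosed
  have hyy : (y, y) ∈ ((fun a => (r a, s a)) '' (B : Set G))ᶜ := by
    rintro ⟨a, haB, ha⟩
    obtain ⟨hr, hs⟩ := Prod.mk.inj ha
    exact hy ⟨a, ⟨haB, congrArg Subtype.val (hr.trans hs.symm)⟩, hr⟩
  obtain ⟨V₁, V₂, hV₁, hV₂, hy₁, hy₂, hV⟩ := isOpen_prod_iff.1 hclosed.isOpen_compl y y hyy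
  exact ⟨W ∩ (V₁ ∩ V₂), Set.inter_subset_left, hW.inter (hV₁.inter hV₂),
    ⟨y, ⟨hyW, hy₁, hy₂⟩, hyC⟩, fun a ha hr hs => hV (Set.mk_mem_prod hr.2.1 hs.2.2) ⟨a, ha, rfl⟩⟩

end Effectivity

end ArrowGroupoid

namespace SteinbergAlgebra

open ArrowGroupoid TopologicalSpace

section Products

variable {R G : Type*} [CommRing R] [TopologicalSpace G] [T2Space G] [ArrowGroupoid G] [IsAmple G]

lemma exists_of_mul_apply_ne_zero {f g : SteinbergAlgebra R G} {γ : G} (h : (f * g) γ ≠ 0) :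
    ∃ (a b : G) (hab : src a = rng b), mul a b hab = γ ∧ f a ≠ 0 ∧ g b ≠ 0 := by
  contrapose! h
  refine finsum_eq_zero_of_forall_eq_zero ?_
  rintro ⟨⟨a, b⟩, hab, rfl⟩
  by_cases hfa : f a = 0
  · rw [hfa, zero_mul]
  · rw [h a b hab rfl hfa, mul_zero]

lemma mul_apply_mul_eq {f g : SteinbergAlgebra R G} {a b : G} (hab : src a = rng b)
    (huniq : ∀ (x y : G) (hxy : src x = rng y), mul x y hxy = mul a b hab →
      f x ≠ 0 → g y ≠ 0 → x = a) :
    (f * g) (mul a b hab) = f a * g b := by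
  rw [mul_apply, conv, finsum_eq_single _ ⟨(a, b), hab, rfl⟩]
  rintro ⟨⟨x, y⟩, hxy, hmul⟩ hne
  by_contra h0
  obtain rfl : x = a := huniq x y hxy hmul (left_ne_zero_of_mul h0) (right_ne_zero_of_mul h0)
  obtain rfl : y = b := mul_left_cancel hmul
  exact hne rfl

variable (R G) in
/-- The functions supported on the unit space; convolution by them is pointwise multiplication. -/
def diagonal : Submodule R (SteinbergAlgebra R G) where
  carrier := {f | ∀ a, src a ≠ a → f a = 0}
  add_mem' hf hg a ha := by rw [add_apply, hf a ha, hg a ha, add_zero]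
  zero_mem' _ _ := rfl
  smul_mem' k f hf a ha := by rw [smul_apply, hf a ha, mul_zero]

lemma mul_apply_of_mem_diagonal_left {f : SteinbergAlgebra R G} (hf : f ∈ diagonal R G)
    (g : SteinbergAlgebra R G) (γ : G) : (f * g) γ = f (rng γ) * g γ := by
  conv_lhs => rw [← rng_mul_self γ]
  refine mul_apply_mul_eq (src_rng γ) fun x y hxy hmul hfx _ => ?_
  have hx : src x = x := not_imp_comm.1 (hf x) hfx
  rw [← rng_of_src_eq hx, ← rng_mul x y hxy, hmul, rng_mul, rng_rng]

lemma mul_apply_of_mem_diagonal_right {f : SteinbergAlgebra R G} (hf : f ∈ diagonal R G)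
    (g : SteinbergAlgebra R G) (γ : G) : (g * f) γ = g γ * f (src γ) := by
  conv_lhs => rw [← mul_src γ]
  refine mul_apply_mul_eq (rng_src γ).symm fun x y hxy hmul _ hfy => ?_
  have hy : src y = y := not_imp_comm.1 (hf y) hfy
  rw [← mul_of_src_eq_right hy hxy, hmul, mul_src]

lemma mul_mem_diagonal {f g : SteinbergAlgebra R G} (hf : f ∈ diagonal R G)
    (hg : g ∈ diagonal R G) : f * g ∈ diagonal R G := fun a ha => by
  rw [mul_apply_of_mem_diagonal_left hf, hg a ha, mul_zero]

end Products

section CharFn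

variable {R G : Type*} [CommRing R] [TopologicalSpace G] [T2Space G]

/-- The characteristic function of a compact open set, the notation `1_D` of the literature. -/
noncomputable def charFn (R : Type*) [CommRing R] (D : CompactOpens G) : SteinbergAlgebra R G :=
  of (LocallyConstant.charFn R ⟨D.isCompact.isClosed, D.isOpen⟩)
    (LocallyConstant.isLocallyConstant _) D D.isCompact fun _ ha => Set.indicator_of_notMem ha _

variable {D : CompactOpens G} {a : G}

lemma charFn_of_mem (ha : a ∈ D) : charFn R D a = 1 :=
  Set.indicator_of_mem (s := (D : Set G)) ha _

lemma charFn_of_notMem (ha : a ∉ D) : charFn R D a = 0 :=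
  Set.indicator_of_notMem (s := (D : Set G)) ha _

lemma mem_of_charFn_ne_zero (ha : charFn R D a ≠ 0) : a ∈ D :=
  not_imp_comm.1 charFn_of_notMem ha

variable [ArrowGroupoid G] [IsAmple G]

lemma charFn_mem_diagonal (hD : (D : Set G) ⊆ {x | src x = x}) : charFn R D ∈ diagonal R G :=
  fun _ ha => charFn_of_notMem fun haD => ha (hD haD)

lemma charFn_mul_apply_mul (hD : IsBisection (D : Set G)) (f : SteinbergAlgebra R G)
    {b : G} (ha : a ∈ D) (hab : src a = rng b) : (charFn R D * f) (mul a b hab) = f b := by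
  rw [mul_apply_mul_eq hab, charFn_of_mem ha, one_mul]
  intro x y hxy hmul hx _
  exact hD.injOn_r (mem_of_charFn_ne_zero hx) ha
    (r_eq_iff.2 (by rw [← rng_mul x y hxy, hmul, rng_mul]))

lemma charFn_mul_mul_charFn_eq_smul {f : SteinbergAlgebra R G} {k : R}
    (hD : (D : Set G) ⊆ {x | src x = x}) (hk : ∀ x ∈ D, f x = k)
    (hf : ∀ a, src a ≠ a → f a ≠ 0 → rng a ∈ D → src a ∉ D) :
    charFn R D * f * charFn R D = k • charFn R D := by
  have hdiag := charFn_mem_diagonal (R := R) hD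
  ext a
  rw [mul_apply_of_mem_diagonal_right hdiag, mul_apply_of_mem_diagonal_left hdiag, smul_apply]
  by_cases ha : src a = a
  · rw [ha, rng_of_src_eq ha]
    by_cases haD : a ∈ D
    · rw [charFn_of_mem haD, hk a haD, one_mul]
    · rw [charFn_of_notMem haD, mul_zero, mul_zero]
  · rw [hdiag a ha, mul_zero]
    by_contra hne
    have hne' := left_ne_zero_of_mul hne
    exact hf a ha (right_ne_zero_of_mul hne')
      (mem_of_charFn_ne_zero (left_ne_zero_of_mul hne'))
      (mem_of_charFn_ne_zero (right_ne_zero_of_mul hne))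

end CharFn

section RestrictionIdeal

variable {R G : Type*} [CommRing R] [TopologicalSpace G] [T2Space G] [ArrowGroupoid G] [IsAmple G]

lemma mem_ofRestrict {U : OpenInvariant G} {f : SteinbergAlgebra R G} :
    f ∈ ofRestrict R U ↔ ∀ a, r a ∉ U.1 → f a = 0 :=
  mem_range_extendByZero _ _ f

/-- The algebra `A_R(G|_U)`, extended by zero, as a two-sided ideal of `A_R(G)`. -/
noncomputable def restrictIdeal (R : Type*) [CommRing R] (U : OpenInvariant G) :
    TwoSidedIdeal (SteinbergAlgebra R G) :=
  TwoSidedIdeal.mk' (ofRestrict R U) (zero_mem _) add_mem neg_mem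
    (fun {f g} hg => mem_ofRestrict.2 fun γ hγ => by
      by_contra hne
      obtain ⟨a, b, hab, rfl, -, hgb⟩ := exists_of_mul_apply_ne_zero hne
      have hb : r b ∈ U.1 := not_imp_comm.1 (mem_ofRestrict.1 hg b) hgb
      have hsa : s a = r b := Subtype.ext hab
      rw [r_eq_iff.2 (rng_mul a b hab)] at hγ
      exact hγ ((U.2 a).2 (by rwa [hsa])))
    (fun {f g} hf => mem_ofRestrict.2 fun γ hγ => by
      by_contra hne
      obtain ⟨a, b, hab, rfl, hfa, -⟩ := exists_of_mul_apply_ne_zero hne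
      rw [r_eq_iff.2 (rng_mul a b hab)] at hγ
      exact hfa (mem_ofRestrict.1 hf a hγ))

lemma coe_restrictIdeal (U : OpenInvariant G) :
    (restrictIdeal R U : Set (SteinbergAlgebra R G)) = ofRestrict R U :=
  TwoSidedIdeal.coe_mk' ..

lemma mem_restrictIdeal {U : OpenInvariant G} {f : SteinbergAlgebra R G} :
    f ∈ restrictIdeal R U ↔ ∀ a, r a ∉ U.1 → f a = 0 :=
  (TwoSidedIdeal.mem_mk' ..).trans mem_ofRestrict

lemma isGraded_restrictIdeal {Γ : Type*} [Group Γ] (c : LCCocycle G Γ) (U : OpenInvariant G) :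
    IsGraded c (restrictIdeal R U) :=
  (isGraded_iff c _).2 fun f hf g => mem_restrictIdeal.2 fun a ha => by
    rw [component_apply, mem_restrictIdeal.1 hf a ha, ite_self]

lemma restrictIdeal_le_iff [Nontrivial R] {U V : OpenInvariant G} :
    restrictIdeal R U ≤ restrictIdeal R V ↔ U ≤ V := by
  refine ⟨fun h x hxU => ?_, fun hUV f hf =>
    mem_restrictIdeal.2 fun a ha => mem_restrictIdeal.1 hf a fun haU => ha (hUV haU)⟩
  obtain ⟨D, hxD, hDU, -⟩ := exists_compactOpens_isBisection
    (U.1.isOpen.preimage continuous_r) (a := (x : G)) (by rwa [Set.mem_preimage, r_coe])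
  have hD : charFn R D ∈ restrictIdeal R U :=
    mem_restrictIdeal.2 fun a ha => charFn_of_notMem fun haD => ha (hDU haD)
  by_contra hxV
  have hx0 := mem_restrictIdeal.1 (h hD) (x : G) (by rwa [r_coe])
  rw [charFn_of_mem hxD] at hx0
  exact one_ne_zero hx0

end RestrictionIdeal

section UnitSupport

variable {R G : Type*} [CommRing R] [TopologicalSpace G] [T2Space G] [ArrowGroupoid G] [IsAmple G]

lemma charFn_mul_mul_charFn_inv_mem_diagonal {D : CompactOpens G} (hD : IsBisection (D : Set G))
    {f : SteinbergAlgebra R G} (hf : f ∈ diagonal R G) :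
    charFn R D * (f * charFn R (D.map inv IsEtale.continuous_inv isOpenMap_inv)) ∈
      diagonal R G := by
  intro γ hγ
  by_contra hne
  obtain ⟨x, y, hxy, rfl, hx, hy⟩ := exists_of_mul_apply_ne_zero hne
  rw [mul_apply_of_mem_diagonal_left hf] at hy
  obtain ⟨d, hd, rfl⟩ := mem_of_charFn_ne_zero (right_ne_zero_of_mul hy)
  obtain rfl : x = d :=
    hD.injOn_s (mem_of_charFn_ne_zero hx) hd (s_eq_iff.2 (hxy.trans (rng_inv d)))
  exact hγ (by rw [ArrowGroupoid.mul_inv, src_rng])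

/-- The open support of the diagonal part of an ideal, i.e. the set of units at which some element
of the ideal supported on the unit space does not vanish. -/
def unitSupport (J : TwoSidedIdeal (SteinbergAlgebra R G)) : Set (UnitSpace G) :=
  {x | ∃ f ∈ J, f ∈ diagonal R G ∧ f (x : G) ≠ 0}

variable {J : TwoSidedIdeal (SteinbergAlgebra R G)}

lemma isOpen_unitSupport : IsOpen (unitSupport J) := by
  refine isOpen_iff_mem_nhds.2 ?_
  rintro x ⟨f, hfJ, hf, hfx⟩
  filter_upwards [(f.isClopen_support.2.preimage continuous_subtype_val).mem_nhds hfx] with y hfy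
  exact ⟨f, hfJ, hf, hfy⟩

lemma r_mem_unitSupport {a : G} (ha : s a ∈ unitSupport J) : r a ∈ unitSupport J := by
  obtain ⟨f, hfJ, hf, hfa⟩ := ha
  obtain ⟨D, haD, -, hD⟩ := exists_compactOpens_isBisection isOpen_univ (Set.mem_univ a)
  have hinv : inv a ∈ D.map inv IsEtale.continuous_inv isOpenMap_inv := ⟨a, haD, rfl⟩
  refine ⟨_, J.mul_mem_left _ _ (J.mul_mem_right _ _ hfJ),
    charFn_mul_mul_charFn_inv_mem_diagonal hD hf, ?_⟩
  change (charFn R D * (f * charFn R (D.map inv IsEtale.continuous_inv isOpenMap_inv))) (rng a) ≠ 0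
  rwa [← ArrowGroupoid.mul_inv a, charFn_mul_apply_mul hD _ haD,
    mul_apply_of_mem_diagonal_left hf, charFn_of_mem hinv, mul_one, rng_inv]

lemma invariant_unitSupport : Invariant (unitSupport J) := fun a =>
  ⟨fun ha => r_inv a ▸ r_mem_unitSupport (by rwa [s_inv]), r_mem_unitSupport⟩

/-- `unitSupport J` as an open invariant set: the inverse of `U ↦ restrictIdeal R U` on graded
ideals. -/
def openSupport (J : TwoSidedIdeal (SteinbergAlgebra R G)) : OpenInvariant G :=
  ⟨⟨unitSupport J, isOpen_unitSupport⟩, invariant_unitSupport⟩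

end UnitSupport

section LocalUnits

variable {K G : Type*} [Field K] [TopologicalSpace G] [T2Space G] [ArrowGroupoid G] [IsAmple G]
  {J : TwoSidedIdeal (SteinbergAlgebra K G)}

lemma exists_mem_diagonal_apply_eq_one {x : UnitSpace G} (hx : x ∈ unitSupport J) :
    ∃ e ∈ J, e ∈ diagonal K G ∧ e (x : G) = 1 := by
  obtain ⟨f, hfJ, hf, hfx⟩ := hx
  obtain ⟨D, hxD, hDu, -⟩ := exists_compactOpens_isBisection isOpen_units x.2
  have hD : (f (x : G))⁻¹ • charFn K D ∈ diagonal K G :=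
    (diagonal K G).smul_mem _ (charFn_mem_diagonal hDu)
  refine ⟨(f (x : G))⁻¹ • charFn K D * f, J.mul_mem_left _ _ hfJ, mul_mem_diagonal hD hf, ?_⟩
  rw [mul_apply_of_mem_diagonal_left hD, rng_of_src_eq x.2, smul_apply, charFn_of_mem hxD, mul_one,
    inv_mul_cancel₀ hfx]

lemma exists_mem_diagonal_eqOn_one {T : Set (UnitSpace G)} (hT : IsCompact T)
    (hTJ : T ⊆ unitSupport J) :
    ∃ e ∈ J, e ∈ diagonal K G ∧ ∀ x ∈ T, e (x : G) = 1 := by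
  refine hT.induction_on (p := fun T => ∃ e ∈ J, e ∈ diagonal K G ∧ ∀ x ∈ T, e (x : G) = 1)
    ⟨0, J.zero_mem, zero_mem _, fun _ => False.elim⟩
    (fun T T' hTT' ⟨e, heJ, he, he1⟩ => ⟨e, heJ, he, fun x hx => he1 x (hTT' hx)⟩) ?_ ?_
  · rintro T T' ⟨e, heJ, he, he1⟩ ⟨e', heJ', he', he1'⟩
    refine ⟨e + e' + -(e * e'),
      J.add_mem (J.add_mem heJ heJ') (J.neg_mem (J.mul_mem_right _ _ heJ)),
      add_mem (add_mem he he') (neg_mem (mul_mem_diagonal he he')), fun x hx => ?_⟩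
    rw [add_apply, add_apply, neg_apply, mul_apply_of_mem_diagonal_left he, rng_of_src_eq x.2]
    rcases hx with hx | hx
    · rw [he1 x hx]; ring
    · rw [he1' x hx]; ring
  · intro x hx
    obtain ⟨e, heJ, he, hex⟩ := exists_mem_diagonal_apply_eq_one (hTJ hx)
    have hopen : IsOpen {y : UnitSpace G | e (y : G) = 1} :=
      (e.isLocallyConstant.isOpen_fiber 1).preimage continuous_subtype_val
    exact ⟨_, mem_nhdsWithin_of_mem_nhds (hopen.mem_nhds hex), e, heJ, he, fun _ hy => hy⟩

lemma restrictIdeal_openSupport_le : restrictIdeal K (openSupport J) ≤ J := by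
  intro f hf
  have hsupp : r '' Function.support f ⊆ unitSupport J := by
    rintro _ ⟨a, ha, rfl⟩
    exact not_imp_comm.1 (mem_restrictIdeal.1 hf a) ha
  obtain ⟨e, heJ, he, he1⟩ :=
    exists_mem_diagonal_eqOn_one (f.isCompact_support.image continuous_r) hsupp
  have hef : e * f = f := by
    ext a
    rw [mul_apply_of_mem_diagonal_left he]
    by_cases ha : f a = 0
    · rw [ha, mul_zero]
    · rw [show e (rng a) = 1 from he1 (r a) ⟨a, ha, rfl⟩, one_mul]
  exact hef ▸ J.mul_mem_right _ _ heJ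

end LocalUnits

section GradedIdeals

variable {R G Γ : Type*} [CommRing R] [TopologicalSpace G] [T2Space G] [ArrowGroupoid G] [IsAmple G]
  [Group Γ]

lemma mem_unitSupport_of_apply_ne_zero {S : ArrowGroupoid.Sub G} (hS : StronglyEffective S.carrier)
    {J : TwoSidedIdeal (SteinbergAlgebra R G)} {f : SteinbergAlgebra R G} (hfJ : f ∈ J)
    (hfS : Function.support f ⊆ S.carrier) {x : UnitSpace G} (hfx : f (x : G) ≠ 0) :
    x ∈ unitSupport J := by
  by_contra hx
  have hBclopen : IsClopen (Function.support f ∩ {a : G | src a = a}ᶜ) :=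
    f.isClopen_support.inter isClopen_units.compl
  let B : CompactOpens G :=
    ⟨⟨_, f.isCompact_support.of_isClosed_subset hBclopen.1 Set.inter_subset_left⟩, hBclopen.2⟩
  have hWopen : IsOpen {y : UnitSpace G | f (y : G) = f (x : G)} :=
    (f.isLocallyConstant.isOpen_fiber _).preimage continuous_subtype_val
  have hC : Invariant (unitSupport J)ᶜ := fun a => not_congr (invariant_unitSupport a)
  obtain ⟨V, hVW, hV, ⟨y, hyV, hyC⟩, hVB⟩ := hS.exists_isOpen_separating hC
    isOpen_unitSupport.isClosed_compl (B := B) (Set.inter_subset_left.trans hfS)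
    (Set.disjoint_left.2 fun _ ha => ha.2) hWopen ⟨x, rfl, hx⟩
  obtain ⟨D, hyD, hDV, -⟩ := exists_compactOpens_isBisection
    (isOpen_units.inter (hV.preimage continuous_r)) ⟨y.2, Set.mem_preimage.2 ((r_coe y).symm ▸ hyV)⟩
  have hDu : (D : Set G) ⊆ {x | src x = x} := fun a ha => (hDV ha).1
  have hmemV (z : UnitSpace G) (hz : (z : G) ∈ D) : z ∈ V := r_coe z ▸ (hDV hz).2
  have hcorner : charFn R D * f * charFn R D = f (x : G) • charFn R D :=
    charFn_mul_mul_charFn_eq_smul hDu (fun z hz => hVW (hmemV ⟨z, hDu hz⟩ hz))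
      fun a ha hfa hra hsa => hVB a ⟨hfa, ha⟩ (hmemV (r a) hra) (hmemV (s a) hsa)
  refine hyC ⟨f (x : G) • charFn R D, ?_,
    (diagonal R G).smul_mem _ (charFn_mem_diagonal hDu), ?_⟩
  · exact hcorner ▸ J.mul_mem_right _ _ (J.mul_mem_left _ _ hfJ)
  · rwa [smul_apply, charFn_of_mem hyD, mul_one]

lemma le_restrictIdeal_openSupport {c : LCCocycle G Γ} (hc : StronglyEffective c.kernel.carrier)
    {J : TwoSidedIdeal (SteinbergAlgebra R G)} (hJ : IsGraded c J) :
    J ≤ restrictIdeal R (openSupport J) := by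
  intro f hf
  refine mem_restrictIdeal.2 fun a ha => ?_
  by_contra hfa
  let g := c.toFun a
  obtain ⟨D, haD, hDg, hD⟩ := exists_compactOpens_isBisection (c.isClopen_fibre g⁻¹).2
    (c.isCocycle.map_inv a)
  have hDhom : charFn R D ∈ homogeneous R c g⁻¹ := fun b hb =>
    charFn_of_notMem fun hbD => hb (hDg hbD)
  have hhom : charFn R D * component c g f ∈ homogeneous R c 1 :=
    inv_mul_cancel g ▸ homogeneous_mul_mem c _ _ _ _ hDhom (component_mem c g f)
  have hval : (charFn R D * component c g f) (src a) = f a := by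
    rw [← ArrowGroupoid.inv_mul a, charFn_mul_apply_mul hD _ haD, component_apply, if_pos rfl]
  have hsa : s a ∈ unitSupport J := mem_unitSupport_of_apply_ne_zero hc
    (J.mul_mem_left _ _ ((isGraded_iff c J).1 hJ f hf g))
    (fun b hb => not_imp_comm.1 (hhom b) hb) (hval.trans_ne hfa)
  exact ha (r_mem_unitSupport hsa)

end GradedIdeals

end SteinbergAlgebra

theorem theorem5p3 {K G Γ : Type*} [Field K] [TopologicalSpace G] [ArrowGroupoid G] [T2Space G]
    [ArrowGroupoid.IsAmple G] [Group Γ] (c : LCCocycle G Γ)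
    (hc : ArrowGroupoid.StronglyEffective c.kernel.carrier) :
    ∃ Φ : SteinbergAlgebra.OpenInvariant G ≃o SteinbergAlgebra.GradedIdeal K c,
      (∀ U, ((Φ U).1 : Set (SteinbergAlgebra K G)) = SteinbergAlgebra.ofRestrict K U) ∧
      (∀ U V, Φ (U ⊔ V) = Φ U ⊔ Φ V) ∧ (∀ U V, Φ (U ⊓ V) = Φ U ⊓ Φ V) := by
  let ι : SteinbergAlgebra.OpenInvariant G ↪o SteinbergAlgebra.GradedIdeal K c :=
    OrderEmbedding.ofMapLEIff
      (fun U => ⟨SteinbergAlgebra.restrictIdeal K U, SteinbergAlgebra.isGraded_restrictIdeal c U⟩)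
      fun _ _ => SteinbergAlgebra.restrictIdeal_le_iff
  have hι : Function.Surjective ι := fun J => ⟨SteinbergAlgebra.openSupport J.1, Subtype.ext
    (le_antisymm SteinbergAlgebra.restrictIdeal_openSupport_le
      (SteinbergAlgebra.le_restrictIdeal_openSupport hc J.2))⟩
  let Φ := RelIso.ofSurjective ι hι
  exact ⟨Φ, SteinbergAlgebra.coe_restrictIdeal, OrderIso.map_sup Φ, OrderIso.map_inf Φ⟩
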